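/- Consider the circular double Sitnikov problem, that is, Hamilton's equations $\dot q_i=\partial H/\partial p_i$, $\dot p_i=-\partial H/\partial q_i$ ($i=3,4$) on $T^*\mathbb R^2$ for $$H=\tfrac12(p_3^2+p_4^2)-\frac1{\sqrt{q_3^2+1/4}}-\frac1{\sqrt{q_4^2+1/4}} .$$ For a solution let $h_i=\tfrac12p_i^2-(q_i^2+\tfrac14)^{-1/2}$ be its (constant) partial energies; then $h_i\ge-2$. For $h\ge -2$ put $k=\frac{\sqrt{2+h}}2$, and let $\mathrm{sn},\mathrm{cn},\mathrm{dn}$ be the Jacobi elliptic functions of modulus $k$ (for $k=1$: $\tanh$, $\operatorname{sech}$, $\operatorname{sech}$; for $k>1$: given by the reciprocal modulus transformation $\mathrm{sn}(u,k)=k^{-1}\mathrm{sn}(ku,k^{-1})$, $\mathrm{cn}(u,k)=\mathrm{dn}(ku,k^{-1})$, $\mathrm{dn}(u,k)=\mathrm{cn}(ku,k^{-1})$). (a) Let $h\ge-2$, and let $U\subseteq\mathbb R$ be a maximal open interval on which $1-2k^2\mathrm{sn}^2(\nu,k)>0$ (so $U=\mathbb R$ if $h<0$). Every primitive $$t=\int\frac{\sqrt2}{4\,(1-2k^2\mathrm{sn}^2(\nu,k))^2}\,d\nu$$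 on $U$ is a bijection from $U$ onto $\mathbb R$; hence it can be inverted to a function $\nu(t)$ defined for all $t\in\mathbb R$. (b) Every solution on an open time interval, with partial energies $h_3,h_4$ and $k_i=\frac{\sqrt{2+h_i}}2$, has the form $$q_i(t)=\varepsilon_i\,\frac{k_i\,\mathrm{sn}(\nu_i(t),k_i)\,\mathrm{dn}(\nu_i(t),k_i)}{1-2k_i^2\,\mathrm{sn}^2(\nu_i(t),k_i)},\qquad p_i(t)=\varepsilon_i\,2\sqrt2\,k_i\,\mathrm{cn}(\nu_i(t),k_i)\qquad(i=3,4),$$ where each $\nu_i$ is obtained by inverting such a primitive with $k=k_i$, where $\varepsilon_i=1$ if $h_i<2$, and $\varepsilon_i\in\{1,-1\}$ if $h_i\ge2$. (c) Conversely, for all $h_3,h_4\ge-2$, all $\varepsilon_i\in\{1,-1\}$ and all $\nu_i$ obtained by inverting such primitives with $k=k_i$, these formulas define a solution for all $t\in\mathbb R$, with partial energies $h_3,h_4$. -/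

import Mathlib

noncomputable section

namespace Sitnikov

/-! Jacobi elliptic functions of a real argument, with modulus `k ≥ 0`. -/

/-- The incomplete elliptic integral of the first kind,
`F(φ, k) = ∫₀^φ dθ / √(1 - k² sin² θ)`. -/
def ellipticF (k φ : ℝ) : ℝ :=
  ∫ θ in (0 : ℝ)..φ, 1 / Real.sqrt (1 - k ^ 2 * Real.sin θ ^ 2)

/-- The Jacobi amplitude for `0 ≤ k < 1`: the inverse of the bijection `F(·, k) : ℝ → ℝ`.
It is only used for such moduli. -/
def jacobiAm (k u : ℝ) : ℝ := Function.invFun (ellipticF k) u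

/-- `sn(u, k)`: it is `sin am` for `k < 1`, the hyperbolic limit for `k = 1`, and for `k > 1` it
is given by the reciprocal modulus transformation `sn(u, k) = k⁻¹ sn(k u, k⁻¹)`. -/
def jacobiSn (k u : ℝ) : ℝ :=
  if k < 1 then Real.sin (jacobiAm k u)
  else if k = 1 then Real.tanh u
  else k⁻¹ * Real.sin (jacobiAm k⁻¹ (k * u))

/-- `cn(u, k)`: it is `cos am` for `k < 1`, the hyperbolic limit for `k = 1`, and for `k > 1` it
is given by the reciprocal modulus transformation `cn(u, k) = dn(k u, k⁻¹)`. -/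
def jacobiCn (k u : ℝ) : ℝ :=
  if k < 1 then Real.cos (jacobiAm k u)
  else if k = 1 then 1 / Real.cosh u
  else Real.sqrt (1 - k⁻¹ ^ 2 * Real.sin (jacobiAm k⁻¹ (k * u)) ^ 2)

/-- `dn(u, k)`: it is `√(1 - k² sn²)` for `k < 1`, the hyperbolic limit for `k = 1`, and for
`k > 1` it is given by the reciprocal modulus transformation `dn(u, k) = cn(k u, k⁻¹)`. -/
def jacobiDn (k u : ℝ) : ℝ :=
  if k < 1 then Real.sqrt (1 - k ^ 2 * Real.sin (jacobiAm k u) ^ 2)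
  else if k = 1 then 1 / Real.cosh u
  else Real.cos (jacobiAm k⁻¹ (k * u))

/-! The circular double Sitnikov problem.  The two secondary bodies are indexed by `Fin 2`. -/

/-- The Hamiltonian `H = |p|²/2 - ∑ᵢ 1/√(qᵢ² + 1/4)` on `T*ℝ²`. -/
def hamiltonian (q p : Fin 2 → ℝ) : ℝ :=
  1 / 2 * ∑ i, p i ^ 2 - ∑ i, 1 / Real.sqrt (q i ^ 2 + 1 / 4)

/-- `t ↦ (q t, p t)` solves Hamilton's equations `q̇ᵢ = ∂H/∂pᵢ`, `ṗᵢ = -∂H/∂qᵢ` on the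
(open) set of times `I`. -/
def IsSolutionOn (I : Set ℝ) (q p : ℝ → Fin 2 → ℝ) : Prop :=
  ∀ t ∈ I, ∀ i : Fin 2,
    HasDerivAt (fun s => q s i)
      (deriv (fun x => hamiltonian (q t) (Function.update (p t) i x)) (p t i)) t ∧
    HasDerivAt (fun s => p s i)
      (-deriv (fun x => hamiltonian (Function.update (q t) i x) (p t)) (q t i)) t

/-- The energy of one secondary body; `H` is the sum of the two partial energies. -/
def partialEnergy (q p : ℝ) : ℝ := p ^ 2 / 2 - 1 / Real.sqrt (q ^ 2 + 1 / 4)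

/-- The modulus `k = √(2 + h) / 2` belonging to the partial energy `h ≥ -2`. -/
def modulus (h : ℝ) : ℝ := Real.sqrt (2 + h) / 2

/-- The position `k sn(ν) dn(ν) / (1 - 2 k² sn²(ν))`. -/
def position (k v : ℝ) : ℝ :=
  k * jacobiSn k v * jacobiDn k v / (1 - 2 * k ^ 2 * jacobiSn k v ^ 2)

/-- The momentum `2 √2 k cn(ν)`. -/
def momentum (k v : ℝ) : ℝ := 2 * Real.sqrt 2 * k * jacobiCn k v

/-- The parameters `ν` with `1 - 2 k² sn²(ν) > 0`.  This is all of `ℝ` if `2 k² < 1`, that is,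
if the partial energy is negative. -/
def regularSet (k : ℝ) : Set ℝ := {v | 0 < 1 - 2 * k ^ 2 * jacobiSn k v ^ 2}

/-- The maximal interval around `v₀` on which `1 - 2 k² sn² > 0` (for `v₀` in `regularSet k`). -/
def branch (k v₀ : ℝ) : Set ℝ := connectedComponentIn (regularSet k) v₀

/-- The time as a function of `ν`: the primitive
`t = C + ∫_{v₀}^ν √2 / (4 (1 - 2 k² sn²(x))²) dx`. -/
def timeFunction (k v₀ C v : ℝ) : ℝ :=
  C + ∫ x in v₀..v, Real.sqrt 2 / (4 * (1 - 2 * k ^ 2 * jacobiSn k x ^ 2) ^ 2)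

/-- `ν : ℝ → ℝ` is obtained by inverting a primitive
`t = ∫ √2 / (4 (1 - 2 k² sn²(ν))²) dν` on one of the intervals where `1 - 2 k² sn² > 0`. -/
def IsTimeInverse (k : ℝ) (ν : ℝ → ℝ) : Prop :=
  ∃ v₀ ∈ regularSet k, ∃ C : ℝ,
    Set.MapsTo ν Set.univ (branch k v₀) ∧
    Set.InvOn ν (timeFunction k v₀ C) (branch k v₀) Set.univ

end Sitnikov

end

namespace Sitnikov

open Filter Topology

/-! ### The Jacobi elliptic functions -/

/-! The Hamiltonian splits into two copies of `q' = p`, `p' = force q`, so one body is treated at a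
time. Write `D = 1 - 2 k² sn²` and `x = k² sn²`. The identity `4 x (1 - x) + (1 - 2 x)² = 1` turns
`√(q² + 1/4)` into `1 / (2 D)`. The potential is then `-2 D`, the energy is `4 k² - 2`, and `dq/dν =
k cn / D²`. Since an inverse of the time integral satisfies `ν' = 2 √2 D²`, the equations of motion
follow by the chain rule (`IsTimeInverse.hasDerivAt_position`, `IsTimeInverse.hasDerivAt_momentum`).

The time integral is onto `ℝ` because it dominates both a linear function and a multiple of `1 / D`.
A branch ends only at infinity or at a zero of `D`, and time diverges in either case
(`bijOn_timeFunction`).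

Completeness of the formulas rests on two facts: they reach every phase point
(`exists_position_momentum_eq`), and the vector field is globally Lipschitz, so initial data
determine the solution (`solution_unique`). The sign `ε` enters for `k ≥ 1`, where `cn` is positive
and the formulas without it give only positive momenta. -/

theorem one_sub_sq_mul_sin_sq_pos {k : ℝ} (hk : 0 ≤ k) (hk1 : k < 1) (θ : ℝ) :
    0 < 1 - k ^ 2 * Real.sin θ ^ 2 := by
  nlinarith [Real.sin_sq_le_one θ, sq_nonneg (Real.sin θ)]

theorem hasStrictDerivAt_ellipticF {k : ℝ} (hk : 0 ≤ k) (hk1 : k < 1) (φ : ℝ) :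
    HasStrictDerivAt (ellipticF k) (1 / Real.sqrt (1 - k ^ 2 * Real.sin φ ^ 2)) φ := by
  have hc : Continuous fun θ : ℝ => 1 / Real.sqrt (1 - k ^ 2 * Real.sin θ ^ 2) :=
    continuous_const.div (by fun_prop)
      fun θ => (Real.sqrt_pos.2 (one_sub_sq_mul_sin_sq_pos hk hk1 θ)).ne'
  exact hc.integral_hasStrictDerivAt 0 φ

/-- The integrand is at least `1`, so `F(φ) - φ` is monotone. This gives strict monotonicity and
divergence at both ends. -/
theorem ellipticF_bijective {k : ℝ} (hk : 0 ≤ k) (hk1 : k < 1) :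
    Function.Bijective (ellipticF k) := by
  have hd := fun φ => (hasStrictDerivAt_ellipticF hk hk1 φ).hasDerivAt
  have hge : ∀ φ, 1 ≤ 1 / Real.sqrt (1 - k ^ 2 * Real.sin φ ^ 2) := fun φ => by
    rw [le_div_iff₀ (Real.sqrt_pos.2 (one_sub_sq_mul_sin_sq_pos hk hk1 φ)), one_mul]
    exact Real.sqrt_le_one.2 (by nlinarith [mul_nonneg (sq_nonneg k) (sq_nonneg (Real.sin φ))])
  have hmono : Monotone fun φ => ellipticF k φ - φ :=
    monotone_of_hasDerivAt_nonneg (fun φ => (hd φ).sub (hasDerivAt_id φ))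
      fun φ => by simpa using hge φ
  have h0 : ellipticF k 0 = 0 := by simp [ellipticF]
  refine ⟨StrictMono.injective fun a b hab => ?_, ?_⟩
  · have := hmono hab.le
    simp only at this
    linarith
  · refine Continuous.surjective (continuous_iff_continuousAt.2 fun φ => (hd φ).continuousAt) ?_ ?_
    · refine tendsto_atTop_mono' _ ?_ tendsto_id
      filter_upwards [eventually_ge_atTop 0] with φ hφ
      have := hmono hφ
      simp only [h0] at this
      simp only [id]
      linarith
    · refine tendsto_atBot_mono' _ ?_ tendsto_id
      filter_upwards [eventually_le_atBot 0] with φ hφ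
      have := hmono hφ
      simp only [h0] at this
      simp only [id]
      linarith

theorem jacobiAm_ellipticF {k : ℝ} (hk : 0 ≤ k) (hk1 : k < 1) (φ : ℝ) :
    jacobiAm k (ellipticF k φ) = φ :=
  Function.leftInverse_invFun (ellipticF_bijective hk hk1).1 φ

theorem hasDerivAt_jacobiAm {k : ℝ} (hk : 0 ≤ k) (hk1 : k < 1) (u : ℝ) :
    HasDerivAt (jacobiAm k) (Real.sqrt (1 - k ^ 2 * Real.sin (jacobiAm k u) ^ 2)) u := by
  obtain ⟨φ, rfl⟩ := (ellipticF_bijective hk hk1).2 u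
  have hpos := Real.sqrt_pos.2 (one_sub_sq_mul_sin_sq_pos hk hk1 φ)
  have := (hasStrictDerivAt_ellipticF hk hk1 φ).to_local_left_inverse (by positivity)
    (Eventually.of_forall (jacobiAm_ellipticF hk hk1))
  rw [jacobiAm_ellipticF hk hk1]
  simpa using this.hasDerivAt

theorem hasDerivAt_sin_jacobiAm {k : ℝ} (hk : 0 ≤ k) (hk1 : k < 1) (u : ℝ) :
    HasDerivAt (fun u => Real.sin (jacobiAm k u)) (Real.cos (jacobiAm k u) *
      Real.sqrt (1 - k ^ 2 * Real.sin (jacobiAm k u) ^ 2)) u :=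
  (hasDerivAt_jacobiAm hk hk1 u).sin

theorem hasDerivAt_cos_jacobiAm {k : ℝ} (hk : 0 ≤ k) (hk1 : k < 1) (u : ℝ) :
    HasDerivAt (fun u => Real.cos (jacobiAm k u)) (-(Real.sin (jacobiAm k u) *
      Real.sqrt (1 - k ^ 2 * Real.sin (jacobiAm k u) ^ 2))) u := by
  simpa using (hasDerivAt_jacobiAm hk hk1 u).cos

theorem hasDerivAt_sqrt_jacobiAm {k : ℝ} (hk : 0 ≤ k) (hk1 : k < 1) (u : ℝ) :
    HasDerivAt (fun u => Real.sqrt (1 - k ^ 2 * Real.sin (jacobiAm k u) ^ 2))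
      (-(k ^ 2 * Real.sin (jacobiAm k u) * Real.cos (jacobiAm k u))) u := by
  have hpos := one_sub_sq_mul_sin_sq_pos hk hk1 (jacobiAm k u)
  have hne := (Real.sqrt_pos.2 hpos).ne'
  refine (((((hasDerivAt_sin_jacobiAm hk hk1 u).fun_pow 2).const_mul (k ^ 2)).const_sub 1).sqrt
    hpos.ne').congr_deriv ?_
  field_simp
  simp
  ring

theorem hasDerivAt_tanh (u : ℝ) :
    HasDerivAt Real.tanh (1 / Real.cosh u * (1 / Real.cosh u)) u := by
  have hc := (Real.cosh_pos u).ne'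
  have := (Real.hasDerivAt_sinh u).div (Real.hasDerivAt_cosh u) hc
  rw [show Real.tanh = Real.sinh / Real.cosh from funext Real.tanh_eq_sinh_div_cosh]
  refine this.congr_deriv ?_
  field_simp
  linarith [Real.cosh_sq u]

theorem hasDerivAt_one_div_cosh (u : ℝ) :
    HasDerivAt (fun u => 1 / Real.cosh u) (-(Real.tanh u * (1 / Real.cosh u))) u := by
  have hc := (Real.cosh_pos u).ne'
  have := (hasDerivAt_const u (1 : ℝ)).div (Real.hasDerivAt_cosh u) hc
  refine this.congr_deriv ?_
  rw [Real.tanh_eq_sinh_div_cosh]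
  field_simp
  ring

/-- The three regimes of the modulus obey the same differential equations; for `k > 1` the
chain-rule factor `k` accounts for the reciprocal modulus. With the two quadratic relations below,
this allows later computations to be uniform in `k`. -/
theorem hasDerivAt_jacobiSn {k : ℝ} (hk : 0 ≤ k) (u : ℝ) :
    HasDerivAt (jacobiSn k) (jacobiCn k u * jacobiDn k u) u := by
  rcases lt_trichotomy k 1 with h | h | h
  · have hS : jacobiSn k = fun u => Real.sin (jacobiAm k u) := by
      funext u; simp only [jacobiSn, if_pos h]
    simpa only [hS, jacobiCn, jacobiDn, if_pos h] using hasDerivAt_sin_jacobiAm hk h u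
  · subst h
    have hS : jacobiSn 1 = Real.tanh := by
      funext u; simp only [jacobiSn, lt_irrefl, if_false, if_true]
    simpa only [hS, jacobiCn, jacobiDn, lt_irrefl, if_false, if_true] using hasDerivAt_tanh u
  · have hS : jacobiSn k = fun u => k⁻¹ * Real.sin (jacobiAm k⁻¹ (k * u)) := by
      funext u; simp only [jacobiSn, h.not_gt, h.ne', if_false]
    simp only [hS, jacobiCn, jacobiDn, h.not_gt, h.ne', if_false]
    have := ((hasDerivAt_sin_jacobiAm (inv_nonneg.2 hk) (inv_lt_one_of_one_lt₀ h) (k * u)).comp u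
      ((hasDerivAt_id u).const_mul k)).const_mul k⁻¹
    refine this.congr_deriv ?_
    field_simp

theorem hasDerivAt_jacobiCn {k : ℝ} (hk : 0 ≤ k) (u : ℝ) :
    HasDerivAt (jacobiCn k) (-(jacobiSn k u * jacobiDn k u)) u := by
  rcases lt_trichotomy k 1 with h | h | h
  · have hS : jacobiCn k = fun u => Real.cos (jacobiAm k u) := by
      funext u; simp only [jacobiCn, if_pos h]
    simpa only [hS, jacobiSn, jacobiDn, if_pos h] using hasDerivAt_cos_jacobiAm hk h u
  · subst h
    have hS : jacobiCn 1 = fun u => 1 / Real.cosh u := by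
      funext u; simp only [jacobiCn, lt_irrefl, if_false, if_true]
    simpa only [hS, jacobiSn, jacobiDn, lt_irrefl, if_false, if_true] using
      hasDerivAt_one_div_cosh u
  · have hS : jacobiCn k =
        fun u => Real.sqrt (1 - k⁻¹ ^ 2 * Real.sin (jacobiAm k⁻¹ (k * u)) ^ 2) := by
      funext u; simp only [jacobiCn, h.not_gt, h.ne', if_false]
    simp only [hS, jacobiSn, jacobiDn, h.not_gt, h.ne', if_false]
    have := (hasDerivAt_sqrt_jacobiAm (inv_nonneg.2 hk) (inv_lt_one_of_one_lt₀ h) (k * u)).comp u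
      ((hasDerivAt_id u).const_mul k)
    refine this.congr_deriv ?_
    field_simp

theorem hasDerivAt_jacobiDn {k : ℝ} (hk : 0 ≤ k) (u : ℝ) :
    HasDerivAt (jacobiDn k) (-(k ^ 2 * jacobiSn k u * jacobiCn k u)) u := by
  rcases lt_trichotomy k 1 with h | h | h
  · have hS : jacobiDn k = fun u => Real.sqrt (1 - k ^ 2 * Real.sin (jacobiAm k u) ^ 2) := by
      funext u; simp only [jacobiDn, if_pos h]
    simpa only [hS, jacobiSn, jacobiCn, if_pos h] using hasDerivAt_sqrt_jacobiAm hk h u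
  · subst h
    have hS : jacobiDn 1 = fun u => 1 / Real.cosh u := by
      funext u; simp only [jacobiDn, lt_irrefl, if_false, if_true]
    simpa only [hS, jacobiSn, jacobiCn, lt_irrefl, if_false, if_true, one_pow, one_mul] using
      hasDerivAt_one_div_cosh u
  · have hS : jacobiDn k = fun u => Real.cos (jacobiAm k⁻¹ (k * u)) := by
      funext u; simp only [jacobiDn, h.not_gt, h.ne', if_false]
    simp only [hS, jacobiSn, jacobiCn, h.not_gt, h.ne', if_false]
    have := (hasDerivAt_cos_jacobiAm (inv_nonneg.2 hk) (inv_lt_one_of_one_lt₀ h) (k * u)).comp u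
      ((hasDerivAt_id u).const_mul k)
    refine this.congr_deriv ?_
    field_simp

/-! ### Quadratic relations and the points they parametrise -/

theorem tanh_sq_add_one_div_cosh_sq (u : ℝ) : Real.tanh u ^ 2 + (1 / Real.cosh u) ^ 2 = 1 := by
  have hc := (Real.cosh_pos u).ne'
  rw [Real.tanh_eq_sinh_div_cosh]
  field_simp
  linarith [Real.cosh_sq u]

theorem jacobiSn_sq_add_jacobiCn_sq {k : ℝ} (hk : 0 ≤ k) (u : ℝ) :
    jacobiSn k u ^ 2 + jacobiCn k u ^ 2 = 1 := by
  rcases lt_trichotomy k 1 with h | h | h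
  · simp only [jacobiSn, jacobiCn, if_pos h, Real.sin_sq_add_cos_sq]
  · simp only [jacobiSn, jacobiCn, h, lt_irrefl, if_false, if_true, tanh_sq_add_one_div_cosh_sq]
  · simp only [jacobiSn, jacobiCn, h.not_gt, h.ne', if_false]
    rw [Real.sq_sqrt (one_sub_sq_mul_sin_sq_pos (inv_nonneg.2 hk) (inv_lt_one_of_one_lt₀ h) _).le]
    ring

theorem sq_mul_jacobiSn_sq_add_jacobiDn_sq {k : ℝ} (hk : 0 ≤ k) (u : ℝ) :
    k ^ 2 * jacobiSn k u ^ 2 + jacobiDn k u ^ 2 = 1 := by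
  rcases lt_trichotomy k 1 with h | h | h
  · simp only [jacobiSn, jacobiDn, if_pos h]
    rw [Real.sq_sqrt (one_sub_sq_mul_sin_sq_pos hk h _).le]
    ring
  · simp only [jacobiSn, jacobiDn, h, lt_irrefl, if_false, if_true, one_pow, one_mul,
      tanh_sq_add_one_div_cosh_sq]
  · simp only [jacobiSn, jacobiDn, h.not_gt, h.ne', if_false]
    rw [← Real.sin_sq_add_cos_sq (jacobiAm k⁻¹ (k * u))]
    field_simp

/-- For `k < 1` every point of the curve `s² + c² = 1`, `k² s² + d² = 1`, `d ≥ 0` is attained. -/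
theorem exists_jacobi_eq_of_lt_one {k s c d : ℝ} (hk : 0 ≤ k) (hk1 : k < 1)
    (hsc : s ^ 2 + c ^ 2 = 1) (hsd : k ^ 2 * s ^ 2 + d ^ 2 = 1) (hd : 0 ≤ d) :
    ∃ u, jacobiSn k u = s ∧ jacobiCn k u = c ∧ jacobiDn k u = d := by
  obtain ⟨φ, rfl, rfl⟩ : ∃ φ, Real.sin φ = s ∧ Real.cos φ = c := by
    have hn : ‖(⟨c, s⟩ : ℂ)‖ = 1 := by
      rw [Complex.norm_eq_sqrt_sq_add_sq, Real.sqrt_eq_one]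
      linarith
    refine ⟨Complex.arg ⟨c, s⟩, ?_, ?_⟩
    · rw [Complex.sin_arg, hn, div_one]
    · rw [Complex.cos_arg (norm_ne_zero_iff.1 (by rw [hn]; exact one_ne_zero)), hn, div_one]
  refine ⟨ellipticF k φ, ?_⟩
  simp only [jacobiSn, jacobiCn, jacobiDn, if_pos hk1, jacobiAm_ellipticF hk hk1, true_and]
  rw [← Real.sqrt_sq hd]
  congr 1
  linarith

/-- For `k > 1` every point of the curve `s² + c² = 1`, `k² s² + d² = 1`, `c ≥ 0` is attained. -/
theorem exists_jacobi_eq_of_one_lt {k s c d : ℝ} (hk1 : 1 < k)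
    (hsc : s ^ 2 + c ^ 2 = 1) (hsd : k ^ 2 * s ^ 2 + d ^ 2 = 1) (hc : 0 ≤ c) :
    ∃ u, jacobiSn k u = s ∧ jacobiCn k u = c ∧ jacobiDn k u = d := by
  have hk0 : 0 < k := by linarith
  have hl := inv_lt_one_of_one_lt₀ hk1
  -- Passing to the reciprocal modulus scales `s` by `k` and exchanges the roles of `c` and `d`.
  obtain ⟨u, h1, h2, h3⟩ := exists_jacobi_eq_of_lt_one (k := k⁻¹) (s := k * s) (c := d) (d := c)
    (inv_nonneg.2 hk0.le) hl (by linarith) (by field_simp; exact hsc) hc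
  simp only [jacobiSn, jacobiCn, jacobiDn, if_pos hl] at h1 h2 h3
  refine ⟨u / k, ?_⟩
  simp only [jacobiSn, jacobiCn, jacobiDn, hk1.not_gt, hk1.ne', if_false,
    mul_div_cancel₀ u hk0.ne', h3]
  exact ⟨by rw [h1, inv_mul_cancel_left₀ hk0.ne'], trivial, h2⟩

theorem exists_jacobi_eq_of_eq_one {s c : ℝ} (hsc : s ^ 2 + c ^ 2 = 1) (hc : 0 < c) :
    ∃ u, jacobiSn 1 u = s ∧ jacobiCn 1 u = c ∧ jacobiDn 1 u = c := by
  have hs : s ∈ Set.Ioo (-1 : ℝ) 1 := abs_lt.1 ((sq_lt_one_iff_abs_lt_one s).1 (by nlinarith))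
  refine ⟨Real.artanh s, ?_⟩
  have : 1 / Real.cosh (Real.artanh s) = c := by
    rw [Real.cosh_artanh hs, one_div_one_div, show 1 - s ^ 2 = c ^ 2 by linarith,
      Real.sqrt_sq hc.le]
  simp only [jacobiSn, jacobiCn, jacobiDn, lt_irrefl, if_false, if_true, Real.tanh_artanh hs, this,
    true_and]

end Sitnikov

namespace Sitnikov

open Filter Topology

/-! ### The time function -/

/-- The quantity `1 - 2 k² sn²(v)`, whose positivity defines `regularSet k`. -/
noncomputable def denominator (k v : ℝ) : ℝ := 1 - 2 * k ^ 2 * jacobiSn k v ^ 2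

theorem hasDerivAt_denominator {k : ℝ} (hk : 0 ≤ k) (v : ℝ) :
    HasDerivAt (denominator k) (-(4 * k ^ 2 * (jacobiSn k v * jacobiCn k v * jacobiDn k v))) v := by
  refine ((((hasDerivAt_jacobiSn hk v).fun_pow 2).const_mul (2 * k ^ 2)).const_sub 1).congr_deriv ?_
  simp
  ring

theorem continuous_denominator {k : ℝ} (hk : 0 ≤ k) : Continuous (denominator k) :=
  continuous_iff_continuousAt.2 fun v => (hasDerivAt_denominator hk v).continuousAt

theorem denominator_le_one (k v : ℝ) : denominator k v ≤ 1 := by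
  unfold denominator
  nlinarith [mul_nonneg (sq_nonneg k) (sq_nonneg (jacobiSn k v))]

/-- Amounts to the bound `4 k²` on the derivative of the denominator. -/
theorem abs_jacobiSn_mul_jacobiCn_mul_jacobiDn_le_one {k : ℝ} (hk : 0 ≤ k) (v : ℝ) :
    |jacobiSn k v * jacobiCn k v * jacobiDn k v| ≤ 1 := by
  have h1 := jacobiSn_sq_add_jacobiCn_sq hk v
  have h2 := sq_mul_jacobiSn_sq_add_jacobiDn_sq hk v
  have hs : |jacobiSn k v| ≤ 1 := (sq_le_one_iff_abs_le_one _).1 (by nlinarith [sq_nonneg (jacobiCn k v)])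
  have hc : |jacobiCn k v| ≤ 1 := (sq_le_one_iff_abs_le_one _).1 (by nlinarith [sq_nonneg (jacobiSn k v)])
  have hd : |jacobiDn k v| ≤ 1 :=
    (sq_le_one_iff_abs_le_one _).1 (by nlinarith [mul_nonneg (sq_nonneg k) (sq_nonneg (jacobiSn k v))])
  rw [abs_mul, abs_mul]
  exact mul_le_one₀ (mul_le_one₀ hs (abs_nonneg _) hc) (abs_nonneg _) hd

theorem isOpen_regularSet {k : ℝ} (hk : 0 ≤ k) : IsOpen (regularSet k) :=
  isOpen_lt continuous_const (continuous_denominator hk)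

theorem isOpen_branch {k : ℝ} (hk : 0 ≤ k) (v₀ : ℝ) : IsOpen (branch k v₀) :=
  (isOpen_regularSet hk).connectedComponentIn

theorem ordConnected_branch (k v₀ : ℝ) : (branch k v₀).OrdConnected :=
  isPreconnected_connectedComponentIn.ordConnected

theorem denominator_pos_of_mem_branch {k v₀ v : ℝ} (hv : v ∈ branch k v₀) : 0 < denominator k v :=
  connectedComponentIn_subset (regularSet k) v₀ hv

theorem mem_branch_self {k v₀ : ℝ} (hv : v₀ ∈ regularSet k) : v₀ ∈ branch k v₀ :=
  mem_connectedComponentIn hv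

/-- Adjoining a limit point keeps the branch connected, so maximality forces the point in. Hence a
finite endpoint of a branch is a zero of the denominator. -/
theorem mem_branch_of_mem_closure {k v₀ b : ℝ} (hv : v₀ ∈ regularSet k)
    (hb : b ∈ closure (branch k v₀)) (hD : 0 < denominator k b) : b ∈ branch k v₀ := by
  have hpre : IsPreconnected (insert b (branch k v₀)) :=
    isPreconnected_connectedComponentIn.subset_closure (Set.subset_insert _ _)
      (Set.insert_subset hb subset_closure)
  exact hpre.subset_connectedComponentIn (Set.mem_insert_of_mem _ (mem_branch_self hv))
    (Set.insert_subset hD (connectedComponentIn_subset _ _)) (Set.mem_insert _ _)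

theorem hasStrictDerivAt_timeFunction {k v₀ v : ℝ} (hk : 0 ≤ k) (h₀ : v₀ ∈ regularSet k) (C : ℝ)
    (hv : v ∈ branch k v₀) :
    HasStrictDerivAt (timeFunction k v₀ C) (Real.sqrt 2 / (4 * denominator k v ^ 2)) v := by
  have hcont : ContinuousOn (fun x => Real.sqrt 2 / (4 * denominator k x ^ 2)) (branch k v₀) := by
    refine continuousOn_const.div
      ((continuous_const.mul ((continuous_denominator hk).pow 2)).continuousOn) fun x hx => ?_
    have := denominator_pos_of_mem_branch hx
    positivity
  have hmem : branch k v₀ ∈ 𝓝 v := (isOpen_branch hk v₀).mem_nhds hv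
  refine HasStrictDerivAt.const_add C (intervalIntegral.integral_hasStrictDerivAt_right ?_ ?_ ?_)
  · exact (hcont.mono ((ordConnected_branch k v₀).uIcc_subset (mem_branch_self h₀) hv)).intervalIntegrable
  · exact hcont.stronglyMeasurableAtFilter (isOpen_branch hk v₀) v hv
  · exact hcont.continuousAt hmem

theorem monotoneOn_of_hasDerivAt_nonneg {S : Set ℝ} (hS : S.OrdConnected) {f f' : ℝ → ℝ}
    (hf : ∀ x ∈ S, HasDerivAt f (f' x) x) (hf' : ∀ x ∈ S, 0 ≤ f' x) : MonotoneOn f S := by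
  refine monotoneOn_of_deriv_nonneg hS.convex
    (fun x hx => (hf x hx).continuousAt.continuousWithinAt)
    (fun x hx => (hf x (interior_subset hx)).differentiableAt.differentiableWithinAt) fun x hx => ?_
  rw [(hf x (interior_subset hx)).deriv]
  exact hf' x (interior_subset hx)

theorem strictMonoOn_timeFunction {k v₀ : ℝ} (hk : 0 ≤ k) (h₀ : v₀ ∈ regularSet k) (C : ℝ) :
    StrictMonoOn (timeFunction k v₀ C) (branch k v₀) := by
  have hd := fun v hv => (hasStrictDerivAt_timeFunction (v := v) hk h₀ C hv).hasDerivAt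
  refine strictMonoOn_of_deriv_pos (ordConnected_branch k v₀).convex
    (fun x hx => (hd x hx).continuousAt.continuousWithinAt) fun x hx => ?_
  rw [(hd x (interior_subset hx)).deriv]
  have := denominator_pos_of_mem_branch (interior_subset hx)
  positivity

/-- The time function grows at least linearly. -/
theorem monotoneOn_timeFunction_sub_linear {k v₀ : ℝ} (hk : 0 ≤ k) (h₀ : v₀ ∈ regularSet k)
    (C : ℝ) : MonotoneOn (fun v => timeFunction k v₀ C v - Real.sqrt 2 / 4 * v) (branch k v₀) := by
  refine monotoneOn_of_hasDerivAt_nonneg (ordConnected_branch k v₀) (fun v hv =>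
    (hasStrictDerivAt_timeFunction hk h₀ C hv).hasDerivAt.sub
      ((hasDerivAt_id v).const_mul (Real.sqrt 2 / 4))) fun v hv => ?_
  have hD := denominator_pos_of_mem_branch hv
  have hD1 := denominator_le_one k v
  rw [mul_one, sub_nonneg]
  gcongr
  nlinarith

/-- Up to sign, the reciprocal of the denominator grows at most as fast as the time function. -/
theorem monotoneOn_timeFunction_add_inv {k v₀ σ : ℝ} (hk : 0 ≤ k) (h₀ : v₀ ∈ regularSet k)
    (hσ : |σ| = 1) (C : ℝ) :
    MonotoneOn (fun v => timeFunction k v₀ C v +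
      σ * (Real.sqrt 2 / (4 * (4 * k ^ 2 + 1)) * (denominator k v)⁻¹)) (branch k v₀) := by
  refine monotoneOn_of_hasDerivAt_nonneg (ordConnected_branch k v₀) (fun v hv =>
    (hasStrictDerivAt_timeFunction hk h₀ C hv).hasDerivAt.add
      ((((hasDerivAt_denominator hk v).fun_inv
        (denominator_pos_of_mem_branch hv).ne').const_mul _).const_mul σ)) fun v hv => ?_
  have hD := denominator_pos_of_mem_branch hv
  set x := jacobiSn k v * jacobiCn k v * jacobiDn k v
  have hx : |σ * x| ≤ 1 := by
    rw [abs_mul, hσ, one_mul]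
    exact abs_jacobiSn_mul_jacobiCn_mul_jacobiDn_le_one hk v
  have hx' := (abs_le.1 hx).1
  -- The constant `4 k² + 1` absorbs the derivative bound `4 k²`; the extra `1` keeps it nonzero
  -- when `k = 0`.
  have : Real.sqrt 2 / (4 * denominator k v ^ 2) +
      σ * (Real.sqrt 2 / (4 * (4 * k ^ 2 + 1)) * (- -(4 * k ^ 2 * x) / denominator k v ^ 2)) =
      Real.sqrt 2 / (4 * (4 * k ^ 2 + 1) * denominator k v ^ 2) *
        (1 + 4 * k ^ 2 * (1 + σ * x)) := by
    field_simp
    ring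
  rw [this]
  have : 0 ≤ 4 * k ^ 2 * (1 + σ * x) := mul_nonneg (by positivity) (by linarith)
  positivity

/-- A function on an open set that grows at least linearly and at least as fast as `1 / D` is
unbounded above, if the set can only end at zeros of `D`. -/
theorem exists_le_of_growth {S : Set ℝ} {D T : ℝ → ℝ} {v₀ a a' : ℝ} (hS : IsOpen S)
    (hv₀ : v₀ ∈ S) (hD : Continuous D) (hpos : ∀ v ∈ S, 0 < D v)
    (hcl : ∀ b ∈ closure S, 0 < D b → b ∈ S) (ha : 0 < a) (ha' : 0 < a')
    (h1 : ∀ v ∈ S, v₀ ≤ v → a * (v - v₀) ≤ T v - T v₀)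
    (h2 : ∀ v ∈ S, v₀ ≤ v → a' * ((D v)⁻¹ - (D v₀)⁻¹) ≤ T v - T v₀) (M : ℝ) :
    ∃ v ∈ S, M ≤ T v := by
  by_contra! hM
  -- If `T` stayed below `M`, the linear bound would make `S'` bounded, and the other bound would
  -- keep `D` away from zero on it. Its supremum would then lie in the open set `S`, which therefore
  -- continues past it.
  set S' := S ∩ Set.Ici v₀
  have hne : S'.Nonempty := ⟨v₀, hv₀, Set.mem_Ici.2 le_rfl⟩
  have hbdd : BddAbove S' := by
    refine ⟨v₀ + (M - T v₀) / a, fun v hv => ?_⟩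
    have := h1 v hv.1 hv.2
    rw [← sub_le_iff_le_add', le_div_iff₀ ha]
    linarith [hM v hv.1]
  have hmem : sSup S' ∈ closure S' := csSup_mem_closure hne hbdd
  set K := (M - T v₀) + a' * (D v₀)⁻¹
  have hKpos : 0 < K := add_pos (by linarith [hM v₀ hv₀])
    (mul_pos ha' (inv_pos.2 (hpos v₀ hv₀)))
  have hlow : ∀ v ∈ S', a' / K ≤ D v := fun v hv => by
    have hDv := hpos v hv.1
    have h3 := h2 v hv.1 hv.2
    have h4 : a' * (D v)⁻¹ ≤ K := by linarith [hM v hv.1]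
    rw [← div_eq_mul_inv, div_le_iff₀ hDv] at h4
    rwa [div_le_iff₀' hKpos]
  have hDb : a' / K ≤ D (sSup S') :=
    closure_minimal (s := S') (t := {v | a' / K ≤ D v}) hlow
      (isClosed_le continuous_const hD) hmem
  have hb : sSup S' ∈ S := hcl _ (closure_mono Set.inter_subset_left hmem)
    (lt_of_lt_of_le (by positivity) hDb)
  obtain ⟨b, hb1, hb2⟩ := ((eventually_mem_set.2 (mem_nhdsWithin_of_mem_nhds (hS.mem_nhds hb))).and
    (self_mem_nhdsWithin (s := Set.Ioi (sSup S')))).exists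
  have hlt : sSup S' < b := hb2
  have : b ≤ sSup S' := le_csSup hbdd ⟨hb1, (le_csSup hbdd ⟨hv₀, Set.mem_Ici.2 le_rfl⟩).trans hlt.le⟩
  linarith

theorem exists_le_timeFunction {k v₀ : ℝ} (hk : 0 ≤ k) (h₀ : v₀ ∈ regularSet k) (C M : ℝ) :
    ∃ v ∈ branch k v₀, M ≤ timeFunction k v₀ C v := by
  have hm := mem_branch_self h₀
  refine exists_le_of_growth (a := Real.sqrt 2 / 4)
    (a' := Real.sqrt 2 / (4 * (4 * k ^ 2 + 1))) (isOpen_branch hk v₀) hm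
    (continuous_denominator hk) (fun v => denominator_pos_of_mem_branch)
    (fun b => mem_branch_of_mem_closure h₀) (by positivity) (by positivity) (fun v hv hle => ?_)
    (fun v hv hle => ?_) M
  · have := monotoneOn_timeFunction_sub_linear hk h₀ C hm hv hle
    simp only at this
    linarith
  · have := monotoneOn_timeFunction_add_inv (σ := -1) hk h₀ (by simp) C hm hv hle
    simp only at this
    linarith

theorem exists_timeFunction_le {k v₀ : ℝ} (hk : 0 ≤ k) (h₀ : v₀ ∈ regularSet k) (C M : ℝ) :
    ∃ v ∈ branch k v₀, timeFunction k v₀ C v ≤ M := by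
  have hm := mem_branch_self h₀
  -- Reversing both the parameter and the time reduces the lower end to the upper one; the needed
  -- sign `σ` changes accordingly.
  suffices ∃ v ∈ Neg.neg ⁻¹' branch k v₀, -M ≤ -timeFunction k v₀ C (-v) from
    let ⟨v, hv, hle⟩ := this
    ⟨-v, hv, neg_le_neg_iff.1 hle⟩
  refine exists_le_of_growth (S := Neg.neg ⁻¹' branch k v₀) (v₀ := -v₀)
    (D := fun v => denominator k (-v)) (T := fun v => -timeFunction k v₀ C (-v))
    (a := Real.sqrt 2 / 4) (a' := Real.sqrt 2 / (4 * (4 * k ^ 2 + 1)))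
    ((isOpen_branch hk v₀).preimage continuous_neg) (by simpa using hm)
    ((continuous_denominator hk).comp continuous_neg) (fun v => denominator_pos_of_mem_branch)
    (fun b hb => mem_branch_of_mem_closure h₀ (continuous_neg.closure_preimage_subset _ hb))
    (by positivity) (by positivity) (fun v hv hle => ?_) (fun v hv hle => ?_) (-M)
  · have := monotoneOn_timeFunction_sub_linear hk h₀ C hv hm (neg_le.1 hle)
    simp only at this
    rw [neg_neg]
    linarith
  · have := monotoneOn_timeFunction_add_inv (σ := 1) hk h₀ (by simp) C hv hm (neg_le.1 hle)
    simp only at this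
    rw [neg_neg]
    linarith

theorem bijOn_timeFunction {k v₀ : ℝ} (hk : 0 ≤ k) (h₀ : v₀ ∈ regularSet k) (C : ℝ) :
    Set.BijOn (timeFunction k v₀ C) (branch k v₀) Set.univ := by
  refine ⟨fun _ _ => trivial, (strictMonoOn_timeFunction hk h₀ C).injOn, fun t _ => ?_⟩
  obtain ⟨v, hv, hvt⟩ := exists_timeFunction_le hk h₀ C t
  obtain ⟨w, hw, hwt⟩ := exists_le_timeFunction hk h₀ C t
  exact isPreconnected_connectedComponentIn.intermediate_value hv hw
    (fun x hx => (hasStrictDerivAt_timeFunction hk h₀ C hx).hasDerivAt.continuousAt.continuousWithinAt)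
    ⟨hvt, hwt⟩

/-! ### Inverses of the time function -/

theorem IsTimeInverse.denominator_pos {k : ℝ} {ν : ℝ → ℝ} (hν : IsTimeInverse k ν) (t : ℝ) :
    0 < denominator k (ν t) := by
  obtain ⟨v₀, -, C, hmaps, -⟩ := hν
  exact denominator_pos_of_mem_branch (hmaps (Set.mem_univ t))

theorem IsTimeInverse.hasDerivAt {k : ℝ} (hk : 0 ≤ k) {ν : ℝ → ℝ} (hν : IsTimeInverse k ν)
    (t : ℝ) : HasDerivAt ν (2 * Real.sqrt 2 * denominator k (ν t) ^ 2) t := by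
  obtain ⟨v₀, h₀, C, hmaps, hleft, hright⟩ := hν
  have hmem := hmaps (Set.mem_univ t)
  have hD := denominator_pos_of_mem_branch hmem
  have := (hasStrictDerivAt_timeFunction hk h₀ C hmem).to_local_left_inverse (by positivity)
    (g := ν) (by filter_upwards [(isOpen_branch hk v₀).mem_nhds hmem] with x hx using hleft hx)
  rw [hright (Set.mem_univ t)] at this
  refine this.hasDerivAt.congr_deriv ?_
  rw [inv_div, div_eq_iff (by positivity)]
  nlinarith [Real.sq_sqrt (show (0 : ℝ) ≤ 2 by norm_num)]

theorem exists_isTimeInverse {k v₀ : ℝ} (hk : 0 ≤ k) (h₀ : v₀ ∈ regularSet k) (t₀ : ℝ) :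
    ∃ ν, IsTimeInverse k ν ∧ ν t₀ = v₀ := by
  -- The integral based at `v₀` vanishes there, so the additive constant `t₀` makes the inverse take
  -- the value `v₀` at `t₀`.
  have hb := bijOn_timeFunction hk h₀ t₀
  have hinv := hb.invOn_invFunOn
  refine ⟨Function.invFunOn (timeFunction k v₀ t₀) (branch k v₀),
    ⟨v₀, h₀, t₀, hb.surjOn.mapsTo_invFunOn, hinv⟩, ?_⟩
  have := hinv.1 (mem_branch_self h₀)
  rwa [show timeFunction k v₀ t₀ v₀ = t₀ by simp [timeFunction]] at this

end Sitnikov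

namespace Sitnikov

open Filter Topology

/-! ### The equations of motion -/

/-- The force `-q / (q² + 1/4)^{3/2}` on one secondary body. -/
noncomputable def force (q : ℝ) : ℝ := -(q / (Real.sqrt (q ^ 2 + 1 / 4) * (q ^ 2 + 1 / 4)))

theorem hasDerivAt_sqrt_sq_add (q : ℝ) : HasDerivAt (fun x => Real.sqrt (x ^ 2 + 1 / 4))
    (q / Real.sqrt (q ^ 2 + 1 / 4)) q := by
  have h0 : q ^ 2 + 1 / 4 ≠ 0 := by positivity
  refine ((((hasDerivAt_id q).fun_pow 2).add_const (1 / 4)).sqrt h0).congr_deriv ?_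
  have : Real.sqrt (q ^ 2 + 1 / 4) ≠ 0 := by positivity
  simp only [id]
  field_simp
  simp

theorem hasDerivAt_one_div_sqrt (q : ℝ) :
    HasDerivAt (fun x => 1 / Real.sqrt (x ^ 2 + 1 / 4)) (force q) q := by
  have hr : Real.sqrt (q ^ 2 + 1 / 4) ≠ 0 := by positivity
  refine ((hasDerivAt_const q (1 : ℝ)).fun_div (hasDerivAt_sqrt_sq_add q) hr).congr_deriv ?_
  have h2 : Real.sqrt (q ^ 2 + 1 / 4) ^ 2 = q ^ 2 + 1 / 4 := Real.sq_sqrt (by positivity)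
  rw [force, h2]
  have h0 : q ^ 2 + 1 / 4 ≠ 0 := by positivity
  field_simp
  simp

theorem deriv_hamiltonian_momentum (q p : Fin 2 → ℝ) (i : Fin 2) :
    deriv (fun x => hamiltonian q (Function.update p i x)) (p i) = p i := by
  refine HasDerivAt.deriv ?_
  have h : HasDerivAt (fun x : ℝ => x ^ 2) (2 * p i) (p i) := by
    simpa using hasDerivAt_pow 2 (p i)
  fin_cases i
  · simp only [hamiltonian, Fin.sum_univ_two]
    have := (((h.add_const (p 1 ^ 2)).const_mul (1 / 2)).sub_const (1 / Real.sqrt (q 0 ^ 2 + 1 / 4) +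
      1 / Real.sqrt (q 1 ^ 2 + 1 / 4))).congr_deriv (show 1 / 2 * (2 * p 0) = p 0 by ring)
    simpa using! this
  · simp only [hamiltonian, Fin.sum_univ_two]
    have := (((h.const_add (p 0 ^ 2)).const_mul (1 / 2)).sub_const (1 / Real.sqrt (q 0 ^ 2 + 1 / 4) +
      1 / Real.sqrt (q 1 ^ 2 + 1 / 4))).congr_deriv (show 1 / 2 * (2 * p 1) = p 1 by ring)
    simpa using! this

theorem deriv_hamiltonian_position (q p : Fin 2 → ℝ) (i : Fin 2) :
    deriv (fun x => hamiltonian (Function.update q i x) p) (q i) = -force (q i) := by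
  refine HasDerivAt.deriv ?_
  have h := hasDerivAt_one_div_sqrt (q i)
  fin_cases i
  · simp only [hamiltonian, Fin.sum_univ_two]
    simpa using! (h.add_const (1 / Real.sqrt (q 1 ^ 2 + 1 / 4))).const_sub
      (1 / 2 * (p 0 ^ 2 + p 1 ^ 2))
  · simp only [hamiltonian, Fin.sum_univ_two]
    simpa using! (h.const_add (1 / Real.sqrt (q 0 ^ 2 + 1 / 4))).const_sub
      (1 / 2 * (p 0 ^ 2 + p 1 ^ 2))

/-- Each partial derivative of the Hamiltonian involves one body only, so the two bodies decouple.
-/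
theorem isSolutionOn_iff {I : Set ℝ} {q p : ℝ → Fin 2 → ℝ} :
    IsSolutionOn I q p ↔ ∀ t ∈ I, ∀ i : Fin 2, HasDerivAt (fun s => q s i) (p t i) t ∧
      HasDerivAt (fun s => p s i) (force (q t i)) t := by
  simp only [IsSolutionOn, deriv_hamiltonian_momentum, deriv_hamiltonian_position, neg_neg]

/-- With `r = √(q² + 1/4) ≥ 1/2` the derivative is `(2 r² - 3/4) / r⁵`. The constant is crude; only
a uniform bound matters, for the Lipschitz property. -/
theorem exists_hasDerivAt_force (q : ℝ) : ∃ f', HasDerivAt force f' q ∧ |f'| ≤ 32 := by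
  set r := Real.sqrt (q ^ 2 + 1 / 4) with hr
  have hrpos : 0 < r := Real.sqrt_pos.2 (by positivity)
  have h2 : r ^ 2 = q ^ 2 + 1 / 4 := Real.sq_sqrt (by positivity)
  have hr2 : 1 / 2 ≤ r := Real.le_sqrt_of_sq_le (by nlinarith [sq_nonneg q])
  have hd : HasDerivAt (fun x : ℝ => x ^ 2 + 1 / 4) (2 * q) q := by
    simpa using (hasDerivAt_pow 2 q).add_const (1 / 4)
  have hne : r * (q ^ 2 + 1 / 4) ≠ 0 := by positivity
  refine ⟨_, ((hasDerivAt_id q).fun_div ((hasDerivAt_sqrt_sq_add q).fun_mul hd) hne).fun_neg, ?_⟩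
  rw [← hr, ← h2]
  have : -((1 * (r * r ^ 2) - id q * (q / r * r ^ 2 + r * (2 * q))) / (r * r ^ 2) ^ 2) =
      (2 * r ^ 2 - 3 / 4) / r ^ 5 := by
    simp only [id]
    field_simp
    rw [show q ^ 2 = r ^ 2 - 1 / 4 by linarith]
    ring
  rw [this, abs_div, abs_of_pos (show 0 < r ^ 5 by positivity), div_le_iff₀ (by positivity)]
  have h3 : (1 / 8 : ℝ) ≤ r ^ 3 := by
    have := pow_le_pow_left₀ (by norm_num : (0 : ℝ) ≤ 1 / 2) hr2 3
    norm_num at this ⊢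
    exact this
  have h5 : r ^ 2 / 8 ≤ r ^ 5 := by nlinarith [mul_le_mul_of_nonneg_left h3 (sq_nonneg r)]
  have h6 : (1 / 4 : ℝ) ≤ r ^ 2 := by nlinarith
  rw [abs_le]
  constructor <;> linarith

theorem lipschitzWith_force : LipschitzWith 32 force := by
  refine lipschitzWith_of_nnnorm_deriv_le
    (fun q => (exists_hasDerivAt_force q).choose_spec.1.differentiableAt) fun q => ?_
  rw [(exists_hasDerivAt_force q).choose_spec.1.deriv, ← NNReal.coe_le_coe]
  simpa using! (exists_hasDerivAt_force q).choose_spec.2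

theorem lipschitzWith_vectorField : LipschitzWith 32 fun x : ℝ × ℝ => (x.2, force x.1) := by
  refine ((LipschitzWith.prod_snd (α := ℝ) (β := ℝ)).prodMk
    (lipschitzWith_force.comp LipschitzWith.prod_fst)).weaken ?_
  norm_num

/-- The global Lipschitz bound requires no a priori control of the solutions; times before and after
`t₀` are handled separately. -/
theorem solution_unique {I : Set ℝ} (hI : I.OrdConnected) {q p q' p' : ℝ → ℝ} {t₀ : ℝ}
    (ht₀ : t₀ ∈ I) (hq : ∀ t ∈ I, HasDerivAt q (p t) t) (hp : ∀ t ∈ I, HasDerivAt p (force (q t)) t)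
    (hq' : ∀ t ∈ I, HasDerivAt q' (p' t) t) (hp' : ∀ t ∈ I, HasDerivAt p' (force (q' t)) t)
    (hq₀ : q t₀ = q' t₀) (hp₀ : p t₀ = p' t₀) {t : ℝ} (ht : t ∈ I) : q t = q' t ∧ p t = p' t := by
  have hf : ∀ t ∈ I, HasDerivAt (fun s => (q s, p s)) (p t, force (q t)) t :=
    fun t ht => (hq t ht).prodMk (hp t ht)
  have hg : ∀ t ∈ I, HasDerivAt (fun s => (q' s, p' s)) (p' t, force (q' t)) t :=
    fun t ht => (hq' t ht).prodMk (hp' t ht)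
  have heq : (q t₀, p t₀) = (q' t₀, p' t₀) := by rw [hq₀, hp₀]
  suffices (q t, p t) = (q' t, p' t) by simpa using this
  rcases le_total t t₀ with h | h
  · have hs : Set.Icc t t₀ ⊆ I := hI.out ht ht₀
    exact ODE_solution_unique_of_mem_Icc_left (v := fun _ x => (x.2, force x.1))
      (s := fun _ => Set.univ) (f := fun s => (q s, p s)) (g := fun s => (q' s, p' s))
      (fun _ _ => lipschitzWith_vectorField.lipschitzOnWith)
      (HasDerivAt.continuousOn fun s hs' => hf s (hs hs'))
      (fun s hs' => (hf s (hs (Set.Ioc_subset_Icc_self hs'))).hasDerivWithinAt)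
      (fun _ _ => trivial)
      (HasDerivAt.continuousOn fun s hs' => hg s (hs hs'))
      (fun s hs' => (hg s (hs (Set.Ioc_subset_Icc_self hs'))).hasDerivWithinAt)
      (fun _ _ => trivial) heq ⟨le_rfl, h⟩
  · have hs : Set.Icc t₀ t ⊆ I := hI.out ht₀ ht
    exact ODE_solution_unique_of_mem_Icc_right (v := fun _ x => (x.2, force x.1))
      (s := fun _ => Set.univ) (f := fun s => (q s, p s)) (g := fun s => (q' s, p' s))
      (fun _ _ => lipschitzWith_vectorField.lipschitzOnWith)
      (HasDerivAt.continuousOn fun s hs' => hf s (hs hs'))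
      (fun s hs' => (hf s (hs (Set.Ico_subset_Icc_self hs'))).hasDerivWithinAt)
      (fun _ _ => trivial)
      (HasDerivAt.continuousOn fun s hs' => hg s (hs hs'))
      (fun s hs' => (hg s (hs (Set.Ico_subset_Icc_self hs'))).hasDerivWithinAt)
      (fun _ _ => trivial) heq ⟨h, le_rfl⟩

/-! ### The explicit formulas -/

theorem position_eq (k v : ℝ) :
    position k v = k * jacobiSn k v * jacobiDn k v / denominator k v := rfl

/-- With `x = k² sn²` this is `4 x (1 - x) + (1 - 2 x)² = 1`, which removes the square root from the
potential. -/
theorem position_sq_add {k v : ℝ} (hk : 0 ≤ k) (hv : 0 < denominator k v) :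
    position k v ^ 2 + 1 / 4 = (1 / (2 * denominator k v)) ^ 2 := by
  rw [position_eq, div_pow, div_pow, mul_pow, mul_pow,
    show jacobiDn k v ^ 2 = 1 - k ^ 2 * jacobiSn k v ^ 2 by
      linarith [sq_mul_jacobiSn_sq_add_jacobiDn_sq hk v]]
  field_simp
  rw [denominator]
  ring

theorem sqrt_position_sq_add {k v : ℝ} (hk : 0 ≤ k) (hv : 0 < denominator k v) :
    Real.sqrt (position k v ^ 2 + 1 / 4) = 1 / (2 * denominator k v) := by
  rw [position_sq_add hk hv, Real.sqrt_sq (by positivity)]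

theorem partialEnergy_position_momentum {k v ε : ℝ} (hk : 0 ≤ k) (hv : 0 < denominator k v)
    (hε : ε ^ 2 = 1) :
    partialEnergy (ε * position k v) (ε * momentum k v) = 4 * k ^ 2 - 2 := by
  rw [partialEnergy, mul_pow, mul_pow, hε, one_mul, one_mul, sqrt_position_sq_add hk hv,
    one_div_one_div, momentum, mul_pow, mul_pow, mul_pow, Real.sq_sqrt (by norm_num),
    denominator, show jacobiCn k v ^ 2 = 1 - jacobiSn k v ^ 2 by
      linarith [jacobiSn_sq_add_jacobiCn_sq hk v]]
  ring

theorem force_position {k v : ℝ} (hk : 0 ≤ k) (hv : 0 < denominator k v) :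
    force (position k v) = -(8 * k * jacobiSn k v * jacobiDn k v * denominator k v ^ 2) := by
  rw [force, sqrt_position_sq_add hk hv, position_sq_add hk hv, position_eq]
  field_simp
  ring

theorem force_mul_of_sq_eq_one {ε : ℝ} (hε : ε ^ 2 = 1) (q : ℝ) : force (ε * q) = ε * force q := by
  rw [force, force, mul_pow, hε, one_mul]
  ring

theorem hasDerivAt_position {k v : ℝ} (hk : 0 ≤ k) (hv : 0 < denominator k v) :
    HasDerivAt (position k) (k * jacobiCn k v / denominator k v ^ 2) v := by
  refine ((((hasDerivAt_jacobiSn hk v).const_mul k).fun_mul (hasDerivAt_jacobiDn hk v)).fun_div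
    (hasDerivAt_denominator hk v) hv.ne').congr_deriv ?_
  congr 1
  have hd : jacobiDn k v ^ 2 = 1 - k ^ 2 * jacobiSn k v ^ 2 := by
    linarith [sq_mul_jacobiSn_sq_add_jacobiDn_sq hk v]
  -- Once `d² = 1 - k² s²` is inserted, the last factor is `D² + 4 x (1 - x) = 1` with `x = k² s²`.
  have : ∀ s c d D : ℝ, (k * (c * d) * d + k * s * -(k ^ 2 * s * c)) * D -
      k * s * d * -(4 * k ^ 2 * (s * c * d)) =
      k * c * ((d ^ 2 - k ^ 2 * s ^ 2) * D + 4 * k ^ 2 * s ^ 2 * d ^ 2) := by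
    intros; ring
  rw [this, hd, denominator]
  ring

theorem hasDerivAt_momentum {k : ℝ} (hk : 0 ≤ k) (v : ℝ) :
    HasDerivAt (momentum k) (2 * Real.sqrt 2 * k * -(jacobiSn k v * jacobiDn k v)) v :=
  (hasDerivAt_jacobiCn hk v).const_mul _

theorem IsTimeInverse.hasDerivAt_position {k : ℝ} (hk : 0 ≤ k) {ν : ℝ → ℝ}
    (hν : IsTimeInverse k ν) (ε t : ℝ) :
    HasDerivAt (fun t => ε * position k (ν t)) (ε * momentum k (ν t)) t := by
  have hD := hν.denominator_pos t
  refine (((Sitnikov.hasDerivAt_position hk hD).comp t (hν.hasDerivAt hk t)).const_mul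
    ε).congr_deriv ?_
  rw [momentum]
  field_simp

theorem IsTimeInverse.hasDerivAt_momentum {k : ℝ} (hk : 0 ≤ k) {ν : ℝ → ℝ}
    (hν : IsTimeInverse k ν) {ε : ℝ} (hε : ε ^ 2 = 1) (t : ℝ) :
    HasDerivAt (fun t => ε * momentum k (ν t)) (force (ε * position k (ν t))) t := by
  have hD := hν.denominator_pos t
  refine (((Sitnikov.hasDerivAt_momentum hk (ν t)).comp t (hν.hasDerivAt hk t)).const_mul
    ε).congr_deriv ?_
  rw [force_mul_of_sq_eq_one hε, force_position hk hD]
  have h2 : Real.sqrt 2 ^ 2 = 2 := Real.sq_sqrt (by norm_num)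
  linear_combination (-4 * ε * k * jacobiSn k (ν t) * jacobiDn k (ν t) *
    denominator k (ν t) ^ 2) * h2

/-! ### Reaching every phase point -/

theorem modulus_nonneg (h : ℝ) : 0 ≤ modulus h := by
  unfold modulus
  positivity

theorem four_mul_modulus_sq {h : ℝ} (hh : -2 ≤ h) : 4 * modulus h ^ 2 = 2 + h := by
  rw [modulus, div_pow, Real.sq_sqrt (by linarith)]
  ring

theorem neg_two_le_partialEnergy (q p : ℝ) : -2 ≤ partialEnergy q p := by
  have h : 1 / 2 ≤ Real.sqrt (q ^ 2 + 1 / 4) :=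
    Real.le_sqrt_of_sq_le (by nlinarith [sq_nonneg q])
  have : 1 / Real.sqrt (q ^ 2 + 1 / 4) ≤ 2 := by
    rw [div_le_iff₀ (by linarith)]
    linarith
  unfold partialEnergy
  linarith [sq_nonneg p]

/-- For `k ≥ 1` only points with positive `cn` are sought. Changing the signs of `s` and `c`
together preserves both relations and reaches the others; it reverses position and momentum
simultaneously. -/
theorem exists_jacobi_eq_up_to_sign {k s c d : ℝ} (hk : 0 ≤ k) (hsc : s ^ 2 + c ^ 2 = 1)
    (hsd : k ^ 2 * s ^ 2 + d ^ 2 = 1) (hd : 0 < d) (hreg : 0 < 1 - 2 * k ^ 2 * s ^ 2) :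
    ∃ u ε : ℝ, (ε = 1 ∨ (ε = -1 ∧ 1 ≤ k)) ∧
      jacobiSn k u = ε * s ∧ jacobiCn k u = ε * c ∧ jacobiDn k u = d := by
  rcases lt_or_ge k 1 with hk1 | hk1
  · obtain ⟨u, h1, h2, h3⟩ := exists_jacobi_eq_of_lt_one hk hk1 hsc hsd hd.le
    exact ⟨u, 1, Or.inl rfl, by rw [h1, one_mul], by rw [h2, one_mul], h3⟩
  -- If `c = 0` then `s² = 1`, and `hreg` would give `2 k² < 1`.
  have hc : c ≠ 0 := by
    rintro rfl
    nlinarith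
  obtain ⟨ε, hε, hpos⟩ : ∃ ε : ℝ, (ε = 1 ∨ (ε = -1 ∧ 1 ≤ k)) ∧ 0 < ε * c := by
    rcases hc.lt_or_gt with h | h
    · exact ⟨-1, Or.inr ⟨rfl, hk1⟩, by linarith⟩
    · exact ⟨1, Or.inl rfl, by linarith⟩
  have hε2 : ε ^ 2 = 1 := by rcases hε with rfl | ⟨rfl, -⟩ <;> norm_num
  have hsc' : (ε * s) ^ 2 + (ε * c) ^ 2 = 1 := by rw [mul_pow, mul_pow, hε2]; linarith
  have hsd' : k ^ 2 * (ε * s) ^ 2 + d ^ 2 = 1 := by rw [mul_pow, hε2]; linarith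
  rcases hk1.eq_or_lt with rfl | hk1
  · obtain ⟨u, h1, h2, h3⟩ := exists_jacobi_eq_of_eq_one hsc' hpos
    refine ⟨u, ε, hε, h1, h2, ?_⟩
    rw [h3]
    exact (pow_left_inj₀ hpos.le hd.le two_ne_zero).1 (by linarith)
  · obtain ⟨u, h⟩ := exists_jacobi_eq_of_one_lt hk1 hsc' hsd' hpos.le
    exact ⟨u, ε, hε, h⟩

/-- Every phase point is given by the explicit formulas. -/
theorem exists_position_momentum_eq (q p : ℝ) :
    ∃ v₀ ∈ regularSet (modulus (partialEnergy q p)), ∃ ε : ℝ,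
      (ε = 1 ∨ (ε = -1 ∧ 2 ≤ partialEnergy q p)) ∧
      q = ε * position (modulus (partialEnergy q p)) v₀ ∧
      p = ε * momentum (modulus (partialEnergy q p)) v₀ := by
  have hk2 := four_mul_modulus_sq (neg_two_le_partialEnergy q p)
  have hk := modulus_nonneg (partialEnergy q p)
  have hE : partialEnergy q p = p ^ 2 / 2 - 1 / Real.sqrt (q ^ 2 + 1 / 4) := rfl
  set k := modulus (partialEnergy q p)
  set r := Real.sqrt (q ^ 2 + 1 / 4)
  have hr2 : r ^ 2 = q ^ 2 + 1 / 4 := Real.sq_sqrt (by positivity)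
  have hr : 1 / 2 ≤ r := Real.le_sqrt_of_sq_le (by nlinarith [sq_nonneg q])
  -- By `sqrt_position_sq_add`, this is the value that the denominator must take.
  obtain ⟨D, hD⟩ : ∃ D, D = 1 / (2 * r) := ⟨_, rfl⟩
  have hDpos : 0 < D := by rw [hD]; positivity
  have hD1 : D ≤ 1 := by
    rw [hD, div_le_iff₀ (by linarith)]
    linarith
  have hDr : 1 / r = 2 * D := by
    rw [hD]
    field_simp
  have hDq : D ^ 2 * (q ^ 2 + 1 / 4) = 1 / 4 := by
    rw [hD, ← hr2]
    field_simp
    norm_num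
  have hp : p ^ 2 = 8 * k ^ 2 - 4 + 4 * D := by
    rw [hDr] at hE
    linarith
  -- Solving for `s` and `c` divides by `k`; at `k = 0` the energy is minimal and only the
  -- equilibrium remains.
  rcases hk.eq_or_lt with hk0 | hkpos
  · rw [← hk0] at hp ⊢
    have hp0 : p = 0 := by
      refine pow_eq_zero_iff two_ne_zero |>.1 (le_antisymm ?_ (sq_nonneg p))
      linarith
    have hD1 : D = 1 := by
      rw [hp0] at hp
      linarith
    have hq0 : q = 0 := by
      refine pow_eq_zero_iff two_ne_zero |>.1 ?_
      rw [hD1] at hDq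
      linarith
    exact ⟨0, by simp [regularSet], 1, Or.inl rfl, by simp [position, hq0], by simp [momentum, hp0]⟩
  -- Eliminating `s` from `D = 1 - 2 k² s²` and `d² = 1 - k² s²` gives `d² = (1 + D) / 2`. Then `s`
  -- and `c` are read off from the position and momentum formulas.
  set d := Real.sqrt ((1 + D) / 2)
  have hd2 : d ^ 2 = (1 + D) / 2 := Real.sq_sqrt (by positivity)
  have hd : 0 < d := Real.sqrt_pos.2 (by positivity)
  obtain ⟨s, hs⟩ : ∃ s, s = q * D / (k * d) := ⟨_, rfl⟩
  obtain ⟨c, hc⟩ : ∃ c, c = p / (2 * Real.sqrt 2 * k) := ⟨_, rfl⟩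
  have hsq : k * s * d = q * D := by
    rw [hs]
    field_simp
  have hcp : 2 * Real.sqrt 2 * k * c = p := by
    rw [hc]
    field_simp
  have hs2 : k ^ 2 * s ^ 2 = (1 - D) / 2 := by
    have h1 : k ^ 2 * s ^ 2 * d ^ 2 = (1 - D) / 2 * d ^ 2 := by
      rw [← mul_pow, ← mul_pow, hsq, hd2]
      linarith
    exact mul_right_cancel₀ (by positivity) h1
  have hc2 : 8 * k ^ 2 * c ^ 2 = p ^ 2 := by
    rw [← hcp, mul_pow, mul_pow, mul_pow, Real.sq_sqrt (by norm_num)]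
    ring
  have hsc : s ^ 2 + c ^ 2 = 1 := by
    have h1 : k ^ 2 * (s ^ 2 + c ^ 2) = k ^ 2 * 1 := by linarith
    exact mul_left_cancel₀ (by positivity) h1
  obtain ⟨u, ε, hε, h1, h2, h3⟩ := exists_jacobi_eq_up_to_sign hk hsc (by linarith) hd
    (by linarith)
  have hε2 : ε ^ 2 = 1 := by rcases hε with rfl | ⟨rfl, -⟩ <;> norm_num
  have hden : 1 - 2 * k ^ 2 * jacobiSn k u ^ 2 = D := by
    rw [h1, mul_pow, hε2]
    linarith
  refine ⟨u, ?_, ε, ?_, ?_, ?_⟩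
  · simpa only [regularSet, Set.mem_ofPred_eq, hden] using hDpos
  · rcases hε with h | ⟨h, hk1⟩
    · exact Or.inl h
    · exact Or.inr ⟨h, by nlinarith⟩
  · rw [position, hden, h1, h3, ← mul_div_assoc, eq_div_iff hDpos.ne']
    linear_combination -hsq - k * s * d * hε2
  · rw [momentum, h2]
    linear_combination -hcp - 2 * Real.sqrt 2 * k * c * hε2

end Sitnikov

theorem mainTheorem3 :
    -- the time integral can be inverted, and its inverse is defined for all times
    (∀ h : ℝ, -2 ≤ h → ∀ v₀ ∈ Sitnikov.regularSet (Sitnikov.modulus h), ∀ C : ℝ,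
      Set.BijOn (Sitnikov.timeFunction (Sitnikov.modulus h) v₀ C)
        (Sitnikov.branch (Sitnikov.modulus h) v₀) Set.univ) ∧
    -- every solution, on any open time interval, is given by the formulas
    (∀ (I : Set ℝ) (q p : ℝ → Fin 2 → ℝ), IsOpen I → I.OrdConnected →
      Sitnikov.IsSolutionOn I q p → ∀ t₀ ∈ I, ∀ h : Fin 2 → ℝ,
      (∀ i, h i = Sitnikov.partialEnergy (q t₀ i) (p t₀ i)) →
      ∃ (ε : Fin 2 → ℝ) (ν : Fin 2 → ℝ → ℝ), ∀ i,
        -2 ≤ h i ∧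
        (ε i = 1 ∨ (ε i = -1 ∧ 2 ≤ h i)) ∧
        Sitnikov.IsTimeInverse (Sitnikov.modulus (h i)) (ν i) ∧
        ∀ t ∈ I,
          q t i = ε i * Sitnikov.position (Sitnikov.modulus (h i)) (ν i t) ∧
          p t i = ε i * Sitnikov.momentum (Sitnikov.modulus (h i)) (ν i t)) ∧
    -- conversely, the formulas always define a solution with the prescribed partial energies
    (∀ (h ε : Fin 2 → ℝ) (ν : Fin 2 → ℝ → ℝ),
      (∀ i, -2 ≤ h i) → (∀ i, ε i = 1 ∨ ε i = -1) →
      (∀ i, Sitnikov.IsTimeInverse (Sitnikov.modulus (h i)) (ν i)) →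
      Sitnikov.IsSolutionOn Set.univ
        (fun t i => ε i * Sitnikov.position (Sitnikov.modulus (h i)) (ν i t))
        (fun t i => ε i * Sitnikov.momentum (Sitnikov.modulus (h i)) (ν i t)) ∧
      ∀ t i, Sitnikov.partialEnergy
        (ε i * Sitnikov.position (Sitnikov.modulus (h i)) (ν i t))
        (ε i * Sitnikov.momentum (Sitnikov.modulus (h i)) (ν i t)) = h i) := by
  refine ⟨fun h _ v₀ hv₀ C => Sitnikov.bijOn_timeFunction (Sitnikov.modulus_nonneg h) hv₀ C, ?_, ?_⟩
  · intro I q p _ hI hsol t₀ ht₀ h hh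
    rw [Sitnikov.isSolutionOn_iff] at hsol
    have key : ∀ i, ∃ (ε : ℝ) (ν : ℝ → ℝ), -2 ≤ h i ∧ (ε = 1 ∨ (ε = -1 ∧ 2 ≤ h i)) ∧
        Sitnikov.IsTimeInverse (Sitnikov.modulus (h i)) ν ∧ ∀ t ∈ I,
          q t i = ε * Sitnikov.position (Sitnikov.modulus (h i)) (ν t) ∧
          p t i = ε * Sitnikov.momentum (Sitnikov.modulus (h i)) (ν t) := fun i => by
      rw [hh i]
      have hk := Sitnikov.modulus_nonneg (Sitnikov.partialEnergy (q t₀ i) (p t₀ i))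
      obtain ⟨v₀, hv₀, ε, hε, hq, hp⟩ := Sitnikov.exists_position_momentum_eq (q t₀ i) (p t₀ i)
      obtain ⟨ν, hν, rfl⟩ := Sitnikov.exists_isTimeInverse hk hv₀ t₀
      have hε2 : ε ^ 2 = 1 := by rcases hε with rfl | ⟨rfl, -⟩ <;> norm_num
      -- The explicit curve through the phase point at `t₀` solves the same system, so uniqueness
      -- identifies it with the given solution on all of `I`.
      exact ⟨ε, ν, Sitnikov.neg_two_le_partialEnergy _ _, hε, hν, fun t ht =>
        Sitnikov.solution_unique hI ht₀ (fun t ht => (hsol t ht i).1) (fun t ht => (hsol t ht i).2)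
          (fun t _ => hν.hasDerivAt_position hk ε t) (fun t _ => hν.hasDerivAt_momentum hk hε2 t)
          hq hp ht⟩
    choose ε ν hεν using key
    exact ⟨ε, ν, hεν⟩
  · intro h ε ν hh hε hν
    have hε2 : ∀ i, ε i ^ 2 = 1 := fun i => by rcases hε i with h | h <;> rw [h] <;> norm_num
    have hk := fun i => Sitnikov.modulus_nonneg (h i)
    refine ⟨Sitnikov.isSolutionOn_iff.2 fun t _ i => ⟨(hν i).hasDerivAt_position (hk i) (ε i) t,
      (hν i).hasDerivAt_momentum (hk i) (hε2 i) t⟩, fun t i => ?_⟩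
    rw [Sitnikov.partialEnergy_position_momentum (hk i) ((hν i).denominator_pos t) (hε2 i),
      Sitnikov.four_mul_modulus_sq (hh i)]
    ring
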